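/- Let $\sigma$ be a partition of the set of all primes into (nonempty, pairwise disjoint) subsets, and let $G$ be a finite group. For a set of primes $\pi$, a $\pi$-group is a finite group whose order is divisible only by primes in $\pi$; a subgroup of a group is $\pi$-maximal if it is a $\pi$-group and is not properly contained in any other subgroup that is a $\pi$-group. A subgroup $P$ of $G$ is a $\mathfrak{G}_\pi$-projector of $G$ if $PN/N$ is a $\pi$-maximal subgroup of $G/N$ for every normal subgroup $N$ of $G$. A subgroup $H$ of $G$ is called $\sigma^{(3)}$-permutable in $G$ if for every $\pi\in\sigma$ there is a $\mathfrak{G}_\pi$-projector $P$ of $G$ such that $HP^x=P^xH$ for all $x\in G$, where $P^x=x^{-1}Px$. If $H$ is a $\sigma^{(3)}$-permutable subgroup of $G$, then its normalizer $N_G(H)$ is also $\sigma^{(3)}$-permutable in $G$. -/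

import Mathlib

open scoped Pointwise

namespace SigmaPerm

universe u

/-- A class of groups, given by its membership predicate. -/
abbrev GroupClass : Type (u + 1) := (G : Type u) → [Group G] → Prop

/-- The class of all (finite) `π`-groups for a set `π` of primes: every prime dividing the order
of the group belongs to `π`. -/
def piGroups (π : Set Nat.Primes) : GroupClass.{u} :=
  fun G _ => Finite G ∧ ∀ p : Nat.Primes, (p : ℕ) ∣ Nat.card G → p ∈ π

/-- `H` is an `𝔛`-maximal subgroup of `G`: it belongs to `𝔛`, and no strictly larger subgroup of
`G` does. -/
def IsMaximalIn (𝔛 : GroupClass.{u}) {G : Type u} [Group G] (H : Subgroup G) : Prop :=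
  Maximal (fun K : Subgroup G => 𝔛 K) H

/-- `H` is an `𝔛`-projector of `G`: for every normal subgroup `N` of `G`, the image `HN/N` of `H`
is an `𝔛`-maximal subgroup of `G/N`. -/
def IsProjector (𝔛 : GroupClass.{u}) {G : Type u} [Group G] (H : Subgroup G) : Prop :=
  ∀ (N : Subgroup G) [N.Normal], IsMaximalIn 𝔛 (H.map (QuotientGroup.mk' N))

/-- The conjugate `P ^ x = x⁻¹ P x`. -/
def conjugate {G : Type u} [Group G] (P : Subgroup G) (x : G) : Subgroup G :=
  P.map (MulAut.conj x⁻¹).toMonoidHom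

/-- `H` is `σ⁽³⁾`-permutable in `G`: for every `π ∈ σ` the group `G` has a `𝔊_π`-projector `P`
such that `H P ^ x = P ^ x H` for all `x ∈ G`. -/
def IsSigma3Permutable (σ : Set (Set Nat.Primes)) {G : Type u} [Group G]
    (H : Subgroup G) : Prop :=
  ∀ π ∈ σ, ∃ P : Subgroup G, IsProjector (piGroups π) P ∧
    ∀ x : G, (H : Set G) * (conjugate P x : Set G) = (conjugate P x : Set G) * (H : Set G)

end SigmaPerm

/-!
Write `O_π(G)` for the greatest normal `π`-subgroup of `G`, and let `P_π`, for `π ∈ σ`, be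
projectors all of whose conjugates permute with `H`. The normalizer of `H` is shown to permute with
the conjugates of the same `P_π`. As the core `H_G` lies in `H` and projectors map to projectors,
`G` may be replaced by `G/H_G`, so let `H` be core-free.

The main step (`isRadicallyEmbedded_of_normalCore_eq_bot`) is that `H` then lies in the product of
the subgroups `O_π(G)`, `π ∈ σ`. By induction on `|G|` and, for fixed `G`, passing to larger
core-free permuting subgroups, `H` may be taken maximal. If no conjugate of a projector moves `H`,
then `H` is normal, because these conjugates generate `G`, and so `H = 1`. Otherwise some `g` in a
conjugate `Q` of `P_π₀` gives `H < H' = ⟨H, H^g⟩ ≤ HQ`. The subgroup `H'` permutes with the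
projectors, so its core `C` is nontrivial, and `|HC : H|` is a `π₀`-number. Comparing indices, the
projectors for the other members of `σ` meet `HC` in subgroups of `H`
(`Permutes.inf_le_of_index`), hence normalize `H ∩ C`. From this it follows that `C` is a
`π₀`-group (`IsIndexExtension.isPiNumber_card`). By induction the claim holds for `HC/C` in `G/C`.
For `π ≠ π₀` the `π`-elements of `H` centralize `C`
(`IsIndexExtension.commute_of_isPiNumber_orderOf`), which lifts the claim from `G/C` to `G`.

Given the main step, `H` is the product of its `π`-part `V = H ∩ O_π(G)` and its `π'`-part
`U = H ∩ O_{π'}(G)`, and `N_G(H) = N_G(U) ∩ N_G(V)`. Since `HP_π ∩ O_{π'}(G) = U`, the projector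
`P_π` normalizes `U`; for the same reason the projectors for the other members of `σ` normalize `V`,
and together with `P_π` they cover `G`, so `N_G(V) P_π = G`. Hence `N_G(H) P_π = N_G(U)` is a
subgroup (`IsRadicallyEmbedded.permutes_normalizer`).
-/

namespace SigmaPerm

universe u

/-! ### `π`-numbers and `π`-subgroups -/

/-- `n` is a `π`-number: all its prime divisors lie in `π`. By this convention `0` is a `π`-number
only when `π` contains all primes; the lemmas are applied to orders and indices in finite groups,
which are positive. -/
def IsPiNumber (π : Set Nat.Primes) (n : ℕ) : Prop :=
  ∀ p : Nat.Primes, (p : ℕ) ∣ n → p ∈ π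

lemma IsPiNumber.of_dvd {π : Set Nat.Primes} {m n : ℕ} (hn : IsPiNumber π n) (h : m ∣ n) :
    IsPiNumber π m :=
  fun p hp => hn p (hp.trans h)

lemma IsPiNumber.mono {π ρ : Set Nat.Primes} {n : ℕ} (hn : IsPiNumber π n) (h : π ⊆ ρ) :
    IsPiNumber ρ n :=
  fun p hp => h (hn p hp)

lemma isPiNumber_one (π : Set Nat.Primes) : IsPiNumber π 1 :=
  fun p hp => absurd (Nat.dvd_one.1 hp) p.2.one_lt.ne'

lemma IsPiNumber.mul {π : Set Nat.Primes} {m n : ℕ} (hm : IsPiNumber π m) (hn : IsPiNumber π n) :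
    IsPiNumber π (m * n) :=
  fun p hp => ((Nat.Prime.dvd_mul p.2).1 hp).elim (hm p) (hn p)

lemma IsPiNumber.eq_one {π ρ : Set Nat.Primes} {n : ℕ} (h : IsPiNumber π n)
    (h' : IsPiNumber ρ n) (hd : Disjoint π ρ) : n = 1 := by
  by_contra hn
  obtain ⟨p, hp, hpn⟩ := Nat.exists_prime_and_dvd hn
  exact Set.disjoint_left.1 hd (h ⟨p, hp⟩ hpn) (h' ⟨p, hp⟩ hpn)

lemma isPiNumber_prime_pow {π : Set Nat.Primes} {p : Nat.Primes} (hp : p ∈ π) (k : ℕ) :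
    IsPiNumber π ((p : ℕ) ^ k) := by
  intro q hq
  have h := (Nat.prime_dvd_prime_iff_eq q.2 p.2).1 (q.2.dvd_of_dvd_pow hq)
  rwa [Subtype.ext h]

section

variable {G : Type u} [Group G]

/-- If the image and the kernel of `f` restricted to `A` are `π`-groups, so is `A`. -/
lemma isPiNumber_card_of_map {K : Type u} [Group K] [Finite G] {π : Set Nat.Primes}
    (A : Subgroup G) (f : G →* K)
    (hker : IsPiNumber π (Nat.card ↥(A ⊓ f.ker))) (hmap : IsPiNumber π (Nat.card (A.map f))) :
    IsPiNumber π (Nat.card A) := by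
  intro p hp
  by_contra hpπ
  have : Fact (p : ℕ).Prime := ⟨p.2⟩
  obtain ⟨x, hx⟩ := exists_prime_orderOf_dvd_card' (p : ℕ) hp
  have hx' : orderOf (x : G) = p := by rw [Subgroup.orderOf_coe, hx]
  have h1 : f x = 1 := by
    rw [← orderOf_eq_one_iff]
    have hd : orderOf (f x) ∣ p := hx' ▸ orderOf_map_dvd f (x : G)
    rcases (Nat.dvd_prime p.2).1 hd with h | h
    · exact h
    · refine absurd (hmap p ?_) hpπ
      rw [← h]
      exact Subgroup.orderOf_dvd_natCard _ (Subgroup.mem_map_of_mem f x.2)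
  refine hpπ (hker p ?_)
  rw [← hx']
  exact Subgroup.orderOf_dvd_natCard _ ⟨x.2, h1⟩

lemma IsPiNumber.of_le {π : Set Nat.Primes} [Finite G] {A B : Subgroup G}
    (hB : IsPiNumber π (Nat.card B)) (h : A ≤ B) : IsPiNumber π (Nat.card A) :=
  hB.of_dvd (Subgroup.card_dvd_of_le h)

lemma IsPiNumber.map {π : Set Nat.Primes} {K : Type u} [Group K] {A : Subgroup G}
    (hA : IsPiNumber π (Nat.card A)) (f : G →* K) : IsPiNumber π (Nat.card (A.map f)) :=
  hA.of_dvd (Subgroup.card_map_dvd A f)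

lemma isPiNumber_card_sup {π : Set Nat.Primes} [Finite G] {A N : Subgroup G} [N.Normal]
    (hA : IsPiNumber π (Nat.card A)) (hN : IsPiNumber π (Nat.card N)) :
    IsPiNumber π (Nat.card ↥(A ⊔ N)) := by
  refine isPiNumber_card_of_map _ (QuotientGroup.mk' N) ?_ ?_
  · rw [QuotientGroup.ker_mk']
    exact hN.of_le inf_le_right
  · rw [Subgroup.map_sup, QuotientGroup.map_mk'_self, sup_bot_eq]
    exact hA.map _

/-- An element whose prime-power-order powers all lie in a subgroup lies in that subgroup. -/
lemma mem_of_forall_prime_pow [Finite G] (S : Subgroup G) (h : G)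
    (hS : ∀ (n : ℕ) (p : Nat.Primes) (k : ℕ), orderOf (h ^ n) = (p : ℕ) ^ k → h ^ n ∈ S) :
    h ∈ S := by
  suffices H : ∀ (a : ℕ), a ∣ orderOf h → h ^ (orderOf h / a) ∈ S by
    simpa [Nat.div_self (orderOf_pos h)] using H (orderOf h) dvd_rfl
  intro a
  induction a using Nat.recOnPosPrimePosCoprime with
  | zero =>
    intro h0
    exact absurd (Nat.eq_zero_of_zero_dvd h0) (orderOf_pos h).ne'
  | one => intro _; simp [pow_orderOf_eq_one]
  | prime_pow p n hp hn =>
    intro hd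
    refine hS _ ⟨p, hp⟩ n ?_
    rw [orderOf_pow_orderOf_div (orderOf_pos h).ne' hd]
  | coprime a b ha hb hab iha ihb =>
    intro hd
    obtain ⟨c, hc⟩ := hd
    have hpos := orderOf_pos h
    have ha0 : 0 < a := by omega
    have hb0 : 0 < b := by omega
    have e1 : orderOf h / (a * b) = c := by
      rw [hc]; exact Nat.mul_div_cancel_left _ (by positivity)
    have e2 : orderOf h / a = b * c := by
      rw [hc, mul_assoc]; exact Nat.mul_div_cancel_left _ ha0
    have e3 : orderOf h / b = a * c := by
      rw [hc, mul_comm a b, mul_assoc]; exact Nat.mul_div_cancel_left _ hb0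
    have m1 := iha ⟨b * c, by rw [hc, mul_assoc]⟩
    have m2 := ihb ⟨a * c, by rw [hc]; ring⟩
    rw [e2] at m1
    rw [e3] at m2
    rw [e1]
    have hbez : (c : ℤ) = (b * c : ℕ) * (a.gcdB b) + (a * c : ℕ) * (a.gcdA b) := by
      have := Nat.gcd_eq_gcd_ab a b
      rw [hab.gcd_eq_one] at this
      push_cast at this ⊢
      linear_combination (c : ℤ) * this
    have : h ^ c = (h ^ (b * c)) ^ (a.gcdB b) * (h ^ (a * c)) ^ (a.gcdA b) := by
      rw [← zpow_natCast h c, hbez, zpow_add, zpow_mul, zpow_mul, zpow_natCast, zpow_natCast]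
    rw [this]
    exact S.mul_mem (S.zpow_mem m1 _) (S.zpow_mem m2 _)

lemma exists_greatest_normal_piSubgroup (π : Set Nat.Primes) (G : Type u) [Group G] [Finite G] :
    ∃ M : Subgroup G, M.Normal ∧ IsPiNumber π (Nat.card M) ∧
      ∀ N : Subgroup G, N.Normal → IsPiNumber π (Nat.card N) → N ≤ M := by
  obtain ⟨M, -, hM⟩ := Set.Finite.exists_le_maximal
    (s := {M : Subgroup G | M.Normal ∧ IsPiNumber π (Nat.card M)}) (Set.toFinite _)
    (a := ⊥) ⟨inferInstance, by simpa using isPiNumber_one π⟩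
  refine ⟨M, hM.prop.1, hM.prop.2, fun N hN hNπ => ?_⟩
  have := hN
  have := hM.prop.1
  exact le_sup_right.trans
    (hM.le_of_ge (y := M ⊔ N) ⟨inferInstance, isPiNumber_card_sup hM.prop.2 hNπ⟩ le_sup_left)

/-- The `π`-radical `O_π(G)`: the greatest normal `π`-subgroup of the finite group `G`. -/
noncomputable def piRadical (π : Set Nat.Primes) (G : Type u) [Group G] [Finite G] : Subgroup G :=
  (exists_greatest_normal_piSubgroup π G).choose

instance piRadical_normal (π : Set Nat.Primes) [Finite G] : (piRadical π G).Normal :=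
  (exists_greatest_normal_piSubgroup π G).choose_spec.1

lemma isPiNumber_card_piRadical (π : Set Nat.Primes) [Finite G] :
    IsPiNumber π (Nat.card (piRadical π G)) :=
  (exists_greatest_normal_piSubgroup π G).choose_spec.2.1

lemma le_piRadical {π : Set Nat.Primes} [Finite G] (N : Subgroup G) [hN : N.Normal]
    (h : IsPiNumber π (Nat.card N)) : N ≤ piRadical π G :=
  (exists_greatest_normal_piSubgroup π G).choose_spec.2.2 N hN h

lemma piRadical_mono {π ρ : Set Nat.Primes} [Finite G] (h : π ⊆ ρ) :
    piRadical π G ≤ piRadical ρ G :=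
  le_piRadical _ ((isPiNumber_card_piRadical π).mono h)

/-! ### Permuting subgroups -/

/-- The subgroups `A` and `B` permute, in elementwise form: `AB ⊆ BA`. Taking inverses shows that
this one inclusion already gives `AB = BA`. -/
def Permutes (A B : Subgroup G) : Prop :=
  ∀ a ∈ A, ∀ b ∈ B, ∃ b' ∈ B, ∃ a' ∈ A, a * b = b' * a'

lemma Permutes.symm {A B : Subgroup G} (h : Permutes A B) : Permutes B A := by
  intro b hb a ha
  obtain ⟨b', hb', a', ha', e⟩ := h a⁻¹ (A.inv_mem ha) b⁻¹ (B.inv_mem hb)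
  refine ⟨a'⁻¹, A.inv_mem ha', b'⁻¹, B.inv_mem hb', ?_⟩
  rw [← mul_inv_rev, ← e]; group

lemma permutes_iff {A B : Subgroup G} :
    Permutes A B ↔ (A : Set G) * (B : Set G) = (B : Set G) * (A : Set G) := by
  constructor
  · intro h
    apply Set.Subset.antisymm
    · rintro _ ⟨a, ha, b, hb, rfl⟩
      obtain ⟨b', hb', a', ha', e⟩ := h a ha b hb
      exact ⟨b', hb', a', ha', e.symm⟩
    · rintro _ ⟨b, hb, a, ha, rfl⟩
      obtain ⟨a', ha', b', hb', e⟩ := h.symm b hb a ha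
      exact ⟨a', ha', b', hb', e.symm⟩
  · intro h a ha b hb
    obtain ⟨b', hb', a', ha', e⟩ :=
      (h ▸ Set.mul_mem_mul ha hb : a * b ∈ (B : Set G) * (A : Set G))
    exact ⟨b', hb', a', ha', e.symm⟩

lemma Permutes.mem_sup {A B : Subgroup G} (h : Permutes A B) {x : G} :
    x ∈ A ⊔ B ↔ ∃ a ∈ A, ∃ b ∈ B, x = a * b := by
  constructor
  · intro hx
    rw [Subgroup.sup_eq_closure_mul] at hx
    induction hx using Subgroup.closure_induction with
    | mem x hx =>
      obtain ⟨a, ha, b, hb, e⟩ := hx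
      exact ⟨a, ha, b, hb, e.symm⟩
    | one => exact ⟨1, A.one_mem, 1, B.one_mem, by simp⟩
    | mul x y _ _ hx hy =>
      obtain ⟨a, ha, b, hb, rfl⟩ := hx
      obtain ⟨c, hc, d, hd, rfl⟩ := hy
      obtain ⟨c', hc', b', hb', e⟩ := h.symm b hb c hc
      refine ⟨a * c', A.mul_mem ha hc', b' * d, B.mul_mem hb' hd, ?_⟩
      rw [mul_assoc, ← mul_assoc b c d, e]; group
    | inv x _ hx =>
      obtain ⟨a, ha, b, hb, rfl⟩ := hx
      obtain ⟨a', ha', b', hb', e⟩ := h.symm b⁻¹ (B.inv_mem hb) a⁻¹ (A.inv_mem ha)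
      exact ⟨a', ha', b', hb', by rw [mul_inv_rev, e]⟩
  · rintro ⟨a, ha, b, hb, rfl⟩
    exact mul_mem (Subgroup.mem_sup_left ha) (Subgroup.mem_sup_right hb)

lemma permutes_of_le_normalizer {A B : Subgroup G} (h : B ≤ Subgroup.normalizer (A : Set G)) :
    Permutes A B := by
  intro a ha b hb
  refine ⟨b, hb, b⁻¹ * a * b, ?_, by group⟩
  have := (Subgroup.mem_normalizer_iff.1 (h (B.inv_mem hb)) a).1 ha
  simpa using this

lemma Permutes.map {K : Type u} [Group K] {A B : Subgroup G} (h : Permutes A B) (f : G →* K) :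
    Permutes (A.map f) (B.map f) := by
  rintro _ ⟨a, ha, rfl⟩ _ ⟨b, hb, rfl⟩
  obtain ⟨b', hb', a', ha', e⟩ := h a ha b hb
  exact ⟨f b', Subgroup.mem_map_of_mem f hb', f a', Subgroup.mem_map_of_mem f ha',
    by rw [← map_mul, e, map_mul]⟩

/-- Dedekind's modular law for permuting subgroups. -/
lemma Permutes.inf_right {A B Y : Subgroup G} (h : Permutes A B) (hA : A ≤ Y) :
    Permutes A (B ⊓ Y) := by
  intro a ha b hb
  obtain ⟨b', hb', a', ha', e⟩ := h a ha b hb.1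
  refine ⟨b', ⟨hb', ?_⟩, a', ha', e⟩
  rw [show b' = a * b * a'⁻¹ by rw [e]; group]
  exact Y.mul_mem (Y.mul_mem (hA ha) hb.2) (Y.inv_mem (hA ha'))

lemma Permutes.sup_left {A₁ A₂ B : Subgroup G} (h₁ : Permutes A₁ B) (h₂ : Permutes A₂ B) :
    Permutes (A₁ ⊔ A₂) B := by
  -- Both `A₁` and `A₂` stabilize the set `B(A₁ ⊔ A₂)` under left translation.
  set S := A₁ ⊔ A₂ with hS
  have key : ∀ A : Subgroup G, A ≤ S → Permutes A B →
      A ≤ MulAction.stabilizer G ((B : Set G) * (S : Set G)) := by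
    intro A hA h a ha
    have hsub : ∀ a ∈ A, ∀ x ∈ (B : Set G) * (S : Set G), a • x ∈ (B : Set G) * (S : Set G) := by
      rintro a ha _ ⟨b, hb, s, hs, rfl⟩
      obtain ⟨b', hb', a', ha', e⟩ := h a ha b hb
      refine ⟨b', hb', a' * s, S.mul_mem (hA ha') hs, ?_⟩
      simp only [smul_eq_mul]
      rw [← mul_assoc, ← mul_assoc, e]
    rw [MulAction.mem_stabilizer_set]
    intro x
    refine ⟨fun hx => ?_, hsub a ha x⟩
    simpa using hsub a⁻¹ (A.inv_mem ha) _ hx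
  have hle : S ≤ MulAction.stabilizer G ((B : Set G) * (S : Set G)) :=
    sup_le (key A₁ le_sup_left h₁) (key A₂ le_sup_right h₂)
  intro s hs b hb
  have := (MulAction.mem_stabilizer_set.1 (hle hs) b).2 ⟨b, hb, 1, S.one_mem, by simp⟩
  obtain ⟨b', hb', s', hs', e⟩ := this
  exact ⟨b', hb', s', hs', e.symm⟩

lemma relIndex_eq_of_forall_mul {A B Y : Subgroup G} (hB : B ≤ Y)
    (h : ∀ y ∈ Y, ∃ b ∈ B, ∃ a ∈ A, y = b * a) : A.relIndex Y = A.relIndex B := by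
  symm
  refine Nat.card_congr
    (Equiv.ofBijective (Subgroup.quotientSubgroupOfEmbeddingOfLE A hB)
      ⟨Function.Embedding.injective _, ?_⟩)
  intro q
  induction q using QuotientGroup.induction_on with
  | H y =>
    obtain ⟨b, hb, a, ha, e⟩ := h y y.2
    refine ⟨QuotientGroup.mk ⟨b, hb⟩, ?_⟩
    rw [Subgroup.quotientSubgroupOfEmbeddingOfLE_apply_mk, QuotientGroup.eq,
      Subgroup.mem_subgroupOf]
    simpa [e] using ha

lemma Permutes.relIndex_sup {A B : Subgroup G} (h : Permutes A B) :
    A.relIndex (A ⊔ B) = A.relIndex B := by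
  refine relIndex_eq_of_forall_mul le_sup_right fun y hy => ?_
  rw [sup_comm] at hy
  exact h.symm.mem_sup.1 hy

/-- A `π`-group `B` permuting with `A` meets an overgroup `Y` of `A` of `π'`-index only in
elements of `A`: the index of `A` in `A(B ∩ Y)` is both a `π`- and a `π'`-number. -/
lemma Permutes.inf_le_of_index {A B Y : Subgroup G} {π ρ : Set Nat.Primes}
    (h : Permutes A B) (hA : A ≤ Y) (hB : IsPiNumber π (Nat.card B))
    (hY : IsPiNumber ρ (A.relIndex Y)) (hd : Disjoint π ρ) : B ⊓ Y ≤ A := by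
  have hp := h.inf_right hA
  have hle : A ⊔ (B ⊓ Y) ≤ Y := sup_le hA inf_le_right
  have h1 : IsPiNumber π (A.relIndex (A ⊔ (B ⊓ Y))) := by
    rw [hp.relIndex_sup]
    exact hB.of_dvd ((Subgroup.relIndex_dvd_card _ _).trans (Subgroup.card_dvd_of_le inf_le_left))
  have h2 : IsPiNumber ρ (A.relIndex (A ⊔ (B ⊓ Y))) :=
    hY.of_dvd ⟨_, (Subgroup.relIndex_mul_relIndex _ _ _ le_sup_left hle).symm⟩
  have := Subgroup.relIndex_eq_one.1 (h1.eq_one h2 hd)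
  exact le_sup_right.trans this

/-! ### Conjugates -/

lemma orderOf_conj (g z : G) : orderOf (g * z * g⁻¹) = orderOf z :=
  orderOf_injective (MulAut.conj g).toMonoidHom (MulAut.conj g).injective z

lemma mem_conjugate {P : Subgroup G} {x z : G} : z ∈ conjugate P x ↔ x * z * x⁻¹ ∈ P := by
  constructor
  · rintro ⟨y, hy, rfl⟩
    simpa [mul_assoc] using hy
  · intro h
    exact ⟨_, h, by simp [mul_assoc]⟩

lemma conjugate_one (P : Subgroup G) : conjugate P 1 = P := by
  ext z; simp [mem_conjugate]

lemma mem_conjugate_mul {P : Subgroup G} {x y z : G} :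
    z ∈ conjugate P (x * y) ↔ y * z * y⁻¹ ∈ conjugate P x := by
  simp [mem_conjugate, mul_assoc]

lemma card_conjugate (P : Subgroup G) (x : G) : Nat.card (conjugate P x) = Nat.card P :=
  Subgroup.card_map_of_injective (MulAut.conj x⁻¹).injective

lemma map_conjugate {K : Type u} [Group K] (P : Subgroup G) (x : G) (f : G →* K) :
    (conjugate P x).map f = conjugate (P.map f) (f x) := by
  ext z
  constructor
  · rintro ⟨y, hy, rfl⟩
    rw [mem_conjugate, ← map_inv, ← map_mul, ← map_mul]
    exact Subgroup.mem_map_of_mem f (mem_conjugate.1 hy)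
  · intro hz
    obtain ⟨w, hw, e⟩ := mem_conjugate.1 hz
    refine ⟨x⁻¹ * w * x, mem_conjugate.2 (by simpa [mul_assoc] using hw), ?_⟩
    simp [e, mul_assoc]

lemma le_conjugate_of_normal {N P : Subgroup G} [N.Normal] (h : N ≤ P) (x : G) :
    N ≤ conjugate P x :=
  fun _ hn => mem_conjugate.2 (h (Subgroup.Normal.conj_mem ‹_› _ hn x))

lemma Permutes.conjugate_left {A P : Subgroup G} (h : ∀ x, Permutes A (conjugate P x)) (g x : G) :
    Permutes (conjugate A g) (conjugate P x) := by
  intro a ha b hb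
  rw [mem_conjugate] at ha
  have hb' : g * b * g⁻¹ ∈ conjugate P (x * g⁻¹) := by
    rw [mem_conjugate_mul]; simpa [mul_assoc] using hb
  obtain ⟨c, hc, d, hd, e⟩ := h _ _ ha _ hb'
  refine ⟨g⁻¹ * c * g, ?_, g⁻¹ * d * g, mem_conjugate.2 (by simpa [mul_assoc] using hd), ?_⟩
  · rw [mem_conjugate_mul] at hc; simpa using hc
  · have : a * b = g⁻¹ * (g * a * g⁻¹ * (g * b * g⁻¹)) * g := by group
    rw [this, e]; group

/-- A subgroup `B` normalizes `S` as soon as conjugation by its elements maps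
`S` into itself. -/
lemma le_normalizer_of_conj_mem {B S : Subgroup G} (h : ∀ b ∈ B, ∀ s ∈ S, b * s * b⁻¹ ∈ S) :
    B ≤ Subgroup.normalizer (S : Set G) := by
  intro b hb
  rw [Subgroup.mem_normalizer_iff]
  intro s
  refine ⟨h b hb s, fun hs => ?_⟩
  simpa [mul_assoc] using h b⁻¹ (B.inv_mem hb) _ hs

/-! ### Systems of projectors -/

/-- `P` is a `𝔊_π`-projector of `G`, phrased with arbitrary surjective homomorphisms in place of
quotient maps, so that the property visibly passes to homomorphic images. -/
def IsImageMaximal (π : Set Nat.Primes) (P : Subgroup G) : Prop :=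
  ∀ (K : Type u) [Group K] (f : G →* K), Function.Surjective f →
    Maximal (fun A : Subgroup K => IsPiNumber π (Nat.card A)) (P.map f)

lemma isImageMaximal_of_isProjector [Finite G] {π : Set Nat.Primes} {P : Subgroup G}
    (hP : IsProjector (piGroups π) P) : IsImageMaximal π P := by
  intro K _ f hf
  have : Finite K := Finite.of_surjective f hf
  have hmax := hP f.ker
  let e : G ⧸ f.ker ≃* K := QuotientGroup.quotientKerEquivOfSurjective f hf
  have hmap : (P.map (QuotientGroup.mk' f.ker)).map e.toMonoidHom = P.map f := by
    rw [Subgroup.map_map]; rfl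
  have hcard : ∀ A : Subgroup (G ⧸ f.ker), Nat.card (A.map e.toMonoidHom) = Nat.card A :=
    fun A => Subgroup.card_map_of_injective e.injective
  have hsurj : ∀ B : Subgroup K, (B.comap e.toMonoidHom).map e.toMonoidHom = B :=
    fun B => Subgroup.map_comap_eq_self_of_surjective e.surjective B
  constructor
  · change IsPiNumber π _
    rw [← hmap, hcard]
    exact hmax.prop.2
  · intro B hB hle
    change IsPiNumber π _ at hB
    rw [← hmap] at hle ⊢
    rw [← hsurj B] at hB ⊢
    rw [hcard] at hB
    exact Subgroup.map_mono
      (hmax.le_of_ge ⟨inferInstance, hB⟩ (Subgroup.map_le_iff_le_comap.1 hle))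

namespace IsImageMaximal

variable {π : Set Nat.Primes} {P : Subgroup G}

lemma isPiNumber_card (hP : IsImageMaximal π P) : IsPiNumber π (Nat.card P) := by
  have := (hP G (MonoidHom.id G) Function.surjective_id).prop
  rwa [Subgroup.map_id] at this

lemma isPiNumber_card_conjugate (hP : IsImageMaximal π P) (x : G) :
    IsPiNumber π (Nat.card (conjugate P x)) := by
  rw [card_conjugate]; exact hP.isPiNumber_card

lemma map (hP : IsImageMaximal π P) {K : Type u} [Group K] (f : G →* K)
    (hf : Function.Surjective f) : IsImageMaximal π (P.map f) := by
  intro L _ g hg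
  rw [Subgroup.map_map]
  exact hP L (g.comp f) (hg.comp hf)

lemma piRadical_le [Finite G] (hP : IsImageMaximal π P) : piRadical π G ≤ P := by
  have h := hP G (MonoidHom.id G) Function.surjective_id
  rw [Subgroup.map_id] at h
  exact le_sup_right.trans (h.le_of_ge (y := P ⊔ piRadical π G)
    (isPiNumber_card_sup h.prop (isPiNumber_card_piRadical π)) le_sup_left)

lemma piRadical_le_conjugate [Finite G] (hP : IsImageMaximal π P) (x : G) :
    piRadical π G ≤ conjugate P x :=
  le_conjugate_of_normal hP.piRadical_le x

/-- If a `𝔊_π`-projector has trivial image, then by Cauchy's theorem the image of the whole group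
is a `π'`-group. -/
lemma isPiNumber_compl_of_map_eq_bot [Finite G] (hP : IsImageMaximal π P) {K : Type u} [Group K]
    (f : G →* K) (hf : Function.Surjective f) (h : P.map f = ⊥) :
    IsPiNumber πᶜ (Nat.card K) := by
  have : Finite K := Finite.of_surjective f hf
  intro p hp hpπ
  have : Fact (p : ℕ).Prime := ⟨p.2⟩
  obtain ⟨x, hx⟩ := exists_prime_orderOf_dvd_card' (p : ℕ) hp
  have hmax := hP K f hf
  rw [h] at hmax
  have hz : Subgroup.zpowers x ≤ ⊥ := by
    refine hmax.le_of_ge ?_ bot_le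
    rw [Nat.card_zpowers, hx]
    simpa using isPiNumber_prime_pow hpπ 1
  have h1 : x = 1 := by simpa using hz
  rw [h1, orderOf_one] at hx
  exact p.2.one_lt.ne hx

end IsImageMaximal

/-- `P` assigns to each `π ∈ σ` a `𝔊_π`-projector of `G` all of whose conjugates permute
with `H`. -/
structure IsPermutingSystem (σ : Set (Set Nat.Primes)) (P : Set Nat.Primes → Subgroup G)
    (H : Subgroup G) : Prop where
  maximal : ∀ π ∈ σ, IsImageMaximal π (P π)
  permutes : ∀ π ∈ σ, ∀ x, Permutes H (conjugate (P π) x)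

lemma IsPermutingSystem.map {σ : Set (Set Nat.Primes)} {P : Set Nat.Primes → Subgroup G}
    {H : Subgroup G} (h : IsPermutingSystem σ P H) {K : Type u} [Group K] (f : G →* K)
    (hf : Function.Surjective f) : IsPermutingSystem σ (fun π => (P π).map f) (H.map f) where
  maximal π hπ := (h.maximal π hπ).map f hf
  permutes π hπ y := by
    obtain ⟨x, rfl⟩ := hf y
    rw [← map_conjugate]
    exact (h.permutes π hπ x).map f

/-- The normal closure of the subgroups `P π` with `π ∈ τ`. -/
def projClosure (τ : Set (Set Nat.Primes)) (P : Set Nat.Primes → Subgroup G) : Subgroup G :=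
  Subgroup.normalClosure (⋃ π ∈ τ, (P π : Set G))

instance projClosure_normal (τ : Set (Set Nat.Primes)) (P : Set Nat.Primes → Subgroup G) :
    (projClosure τ P).Normal :=
  Subgroup.normalClosure_normal

lemma le_projClosure {τ : Set (Set Nat.Primes)} (P : Set Nat.Primes → Subgroup G)
    {π : Set Nat.Primes} (hπ : π ∈ τ) : P π ≤ projClosure τ P :=
  fun _ hx => Subgroup.subset_normalClosure (Set.mem_biUnion hπ hx)

lemma projClosure_le {τ : Set (Set Nat.Primes)} {P : Set Nat.Primes → Subgroup G}
    {S : Subgroup G} (h : ∀ π ∈ τ, ∀ x, conjugate (P π) x ≤ S) : projClosure τ P ≤ S := by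
  refine (Subgroup.closure_le _).2 fun y hy => ?_
  obtain ⟨a, ha, hay⟩ := Group.mem_conjugatesOfSet_iff.1 hy
  obtain ⟨π, hπ, haπ⟩ := Set.mem_iUnion₂.1 ha
  obtain ⟨c, rfl⟩ := isConj_iff.1 hay
  exact h π hπ c⁻¹ (mem_conjugate.2 (by simpa [mul_assoc] using haπ))

lemma isPiNumber_card_quotient_projClosure [Finite G] {τ : Set (Set Nat.Primes)}
    {P : Set Nat.Primes → Subgroup G} (hP : ∀ π ∈ τ, IsImageMaximal π (P π)) :
    IsPiNumber {p | ∀ π ∈ τ, p ∉ π} (Nat.card (G ⧸ projClosure τ P)) := by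
  intro p hp π hπ
  refine (hP π hπ).isPiNumber_compl_of_map_eq_bot (QuotientGroup.mk' (projClosure τ P))
    (QuotientGroup.mk'_surjective _) ?_ p hp
  rw [Subgroup.map_eq_bot_iff, QuotientGroup.ker_mk']
  exact le_projClosure P hπ

lemma disjoint_of_isPartition {σ : Set (Set Nat.Primes)} (hσ : Setoid.IsPartition σ)
    {π ρ : Set Nat.Primes} (hπ : π ∈ σ) (hρ : ρ ∈ σ) (hne : π ≠ ρ) : Disjoint π ρ :=
  hσ.pairwiseDisjoint hπ hρ hne

lemma projClosure_eq_top [Finite G] {σ : Set (Set Nat.Primes)} (hσ : Setoid.IsPartition σ)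
    {P : Set Nat.Primes → Subgroup G} (hP : ∀ π ∈ σ, IsImageMaximal π (P π)) :
    projClosure σ P = ⊤ := by
  have h := isPiNumber_card_quotient_projClosure hP
  have h1 : (projClosure σ P).index = 1 := by
    refine h.eq_one (ρ := Set.univ) (fun p _ => trivial) ?_
    rw [Set.disjoint_univ]
    ext p
    obtain ⟨π, ⟨hπ, hp⟩, -⟩ := hσ.2 p
    simpa using ⟨π, hπ, hp⟩
  exact Subgroup.index_eq_one.1 h1

/-- The projectors for the members of `σ` other than `π` generate, up to conjugacy, a normal
subgroup with `π`-quotient. -/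
lemma isPiNumber_card_quotient_projClosure_diff [Finite G] {σ : Set (Set Nat.Primes)}
    (hσ : Setoid.IsPartition σ)
    {P : Set Nat.Primes → Subgroup G} (hP : ∀ π ∈ σ, IsImageMaximal π (P π))
    (π : Set Nat.Primes) :
    IsPiNumber π (Nat.card (G ⧸ projClosure (σ \ {π}) P)) := by
  refine (isPiNumber_card_quotient_projClosure fun ρ hρ => hP ρ hρ.1).mono fun p hp => ?_
  obtain ⟨ρ, ⟨hρ, hpρ⟩, -⟩ := hσ.2 p
  by_cases h : ρ = π
  · exact h ▸ hpρ
  · exact absurd hpρ (hp ρ ⟨hρ, h⟩)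

/-- The quotient by the normal subgroup is a `π`-group, hence covered by the image of every
conjugate of the projector `P π`. -/
lemma exists_mem_projClosure_mul [Finite G] {σ : Set (Set Nat.Primes)}
    (hσ : Setoid.IsPartition σ)
    {P : Set Nat.Primes → Subgroup G} (hP : ∀ π ∈ σ, IsImageMaximal π (P π))
    {π : Set Nat.Primes} (hπ : π ∈ σ) (x g : G) :
    ∃ k ∈ projClosure (σ \ {π}) P, ∃ p ∈ conjugate (P π) x, g = k * p := by
  set K := projClosure (σ \ {π}) P
  have hmax := (hP π hπ).map (QuotientGroup.mk' K) (QuotientGroup.mk'_surjective K)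
  have hg : (QuotientGroup.mk' K) g ∈ (conjugate (P π) x).map (QuotientGroup.mk' K) := by
    rw [map_conjugate]
    refine hmax.piRadical_le_conjugate _ ?_
    refine le_piRadical (⊤ : Subgroup (G ⧸ K)) ?_ trivial
    rw [Subgroup.card_top]
    exact isPiNumber_card_quotient_projClosure_diff hσ hP π
  obtain ⟨p, hp, e⟩ := hg
  refine ⟨g * p⁻¹, ?_, p, hp, by group⟩
  rw [← QuotientGroup.ker_mk' K, MonoidHom.mem_ker, map_mul, map_inv, e, mul_inv_cancel]

/-! ### Normalizers of subgroups contained in the product of the radicals -/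

/-- For each `π ∈ σ` the `π`-elements of `H` lie in `O_π(G)`. For a partition `σ` of the primes
this says that `H` lies in the product of the normal subgroups `O_π(G)`, `π ∈ σ`. -/
def IsRadicallyEmbedded [Finite G] (σ : Set (Set Nat.Primes)) (H : Subgroup G) : Prop :=
  ∀ π ∈ σ, ∀ h ∈ H, IsPiNumber π (orderOf h) → h ∈ piRadical π G

namespace IsRadicallyEmbedded

variable [Finite G] {σ : Set (Set Nat.Primes)} {P : Set Nat.Primes → Subgroup G} {H : Subgroup G}

lemma mem_piRadical_compl (hσ : Setoid.IsPartition σ) (hR : IsRadicallyEmbedded σ H)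
    {π : Set Nat.Primes} (hπ : π ∈ σ) {h : G} (hh : h ∈ H) (ho : IsPiNumber πᶜ (orderOf h)) :
    h ∈ piRadical πᶜ G := by
  refine mem_of_forall_prime_pow _ h fun n p k hk => ?_
  rcases eq_or_ne k 0 with rfl | hk0
  · rw [pow_zero, orderOf_eq_one_iff] at hk
    rw [hk]; exact one_mem _
  have hp : p ∉ π := ho p (((dvd_pow_self _ hk0).trans hk.symm.dvd).trans (orderOf_pow_dvd n))
  obtain ⟨ρ, ⟨hρ, hpρ⟩, -⟩ := hσ.2 p
  have hne : ρ ≠ π := fun h => hp (h ▸ hpρ)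
  exact piRadical_mono ((disjoint_of_isPartition hσ hρ hπ hne).subset_compl_right)
    (hR ρ hρ _ (H.pow_mem hh n) (hk ▸ isPiNumber_prime_pow hpρ k))

lemma eq_sup (hσ : Setoid.IsPartition σ) (hR : IsRadicallyEmbedded σ H)
    {π : Set Nat.Primes} (hπ : π ∈ σ) : H = (H ⊓ piRadical π G) ⊔ (H ⊓ piRadical πᶜ G) := by
  refine le_antisymm (fun h hh => ?_) (sup_le inf_le_left inf_le_left)
  refine mem_of_forall_prime_pow _ h fun n p k hk => ?_
  have hn := H.pow_mem hh n
  by_cases hp : p ∈ π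
  · exact Subgroup.mem_sup_left ⟨hn, hR π hπ _ hn (hk ▸ isPiNumber_prime_pow hp k)⟩
  · exact Subgroup.mem_sup_right
      ⟨hn, hR.mem_piRadical_compl hσ hπ hn (hk ▸ isPiNumber_prime_pow hp k)⟩

/-- The projector `P` for `π` normalizes the `π'`-part of `H`, as `HP ∩ O_{π'}(G)` equals
`H ∩ O_{π'}(G)`. -/
lemma conjugate_le_normalizer_compl (hσ : Setoid.IsPartition σ) (hR : IsRadicallyEmbedded σ H)
    (hP : IsPermutingSystem σ P H) {π : Set Nat.Primes} (hπ : π ∈ σ) (x : G) :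
    conjugate (P π) x ≤ Subgroup.normalizer ((H ⊓ piRadical πᶜ G : Subgroup G) : Set G) := by
  set U := H ⊓ piRadical πᶜ G with hU
  refine le_normalizer_of_conj_mem fun p hp u hu => ?_
  have hc : p * u * p⁻¹ ∈ piRadical πᶜ G := Subgroup.Normal.conj_mem inferInstance _ hu.2 _
  have hs : p * u * p⁻¹ ∈ H ⊔ conjugate (P π) x :=
    mul_mem (mul_mem (Subgroup.mem_sup_right hp) (Subgroup.mem_sup_left hu.1))
      (Subgroup.inv_mem _ (Subgroup.mem_sup_right hp))
  obtain ⟨h, hh, q, hq, e⟩ := (hP.permutes π hπ x).mem_sup.1 hs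
  rw [hR.eq_sup hσ hπ, sup_comm] at hh
  have hperm : Permutes U (H ⊓ piRadical π G) := by
    refine permutes_of_le_normalizer (le_normalizer_of_conj_mem fun v hv w hw => ?_)
    exact ⟨mul_mem (mul_mem hv.1 hw.1) (Subgroup.inv_mem _ hv.1),
      Subgroup.Normal.conj_mem inferInstance _ hw.2 _⟩
  obtain ⟨w, hw, v, hv, rfl⟩ := hperm.mem_sup.1 hh
  have hvP : v * q ∈ conjugate (P π) x :=
    mul_mem ((hP.maximal π hπ).piRadical_le_conjugate x hv.2) hq
  have hvR : v * q ∈ piRadical πᶜ G := by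
    have : v * q = w⁻¹ * (p * u * p⁻¹) := by rw [e]; group
    rw [this]
    exact mul_mem (inv_mem hw.2) hc
  have h1 : v * q = 1 := by
    rw [← orderOf_eq_one_iff]
    refine IsPiNumber.eq_one (π := π) (ρ := πᶜ) ?_ ?_ disjoint_compl_right
    · exact ((hP.maximal π hπ).isPiNumber_card_conjugate x).of_dvd
        (Subgroup.orderOf_dvd_natCard _ hvP)
    · exact (isPiNumber_card_piRadical πᶜ).of_dvd (Subgroup.orderOf_dvd_natCard _ hvR)
  rw [e, mul_assoc, h1, mul_one]
  exact hw

/-- The `π`-part of `H` is normalized by the projectors for the other members of `σ`: it is the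
intersection of `O_π(G)` with the `ρ'`-part of `H`. -/
lemma conjugate_le_normalizer (hσ : Setoid.IsPartition σ) (hR : IsRadicallyEmbedded σ H)
    (hP : IsPermutingSystem σ P H) {π ρ : Set Nat.Primes} (hπ : π ∈ σ) (hρ : ρ ∈ σ)
    (hne : ρ ≠ π) (x : G) :
    conjugate (P ρ) x ≤ Subgroup.normalizer ((H ⊓ piRadical π G : Subgroup G) : Set G) := by
  have hle : piRadical π G ≤ piRadical ρᶜ G :=
    piRadical_mono (disjoint_of_isPartition hσ hρ hπ hne).symm.subset_compl_right
  refine le_normalizer_of_conj_mem fun p hp v hv => ⟨?_, ?_⟩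
  · exact ((Subgroup.mem_normalizer_iff.1
      (hR.conjugate_le_normalizer_compl hσ hP hρ x hp) v).1 ⟨hv.1, hle hv.2⟩).1
  · exact Subgroup.Normal.conj_mem inferInstance _ hv.2 _

/-- `N_G(H)` is the intersection of the normalizers of the `π'`-part `U` and the `π`-part `V` of
`H`. Since `P ≤ N_G(U)` and `N_G(V)P = G`, it follows that `N_G(H)P = N_G(U)`. -/
lemma permutes_normalizer (hσ : Setoid.IsPartition σ) (hR : IsRadicallyEmbedded σ H)
    (hP : IsPermutingSystem σ P H) {π : Set Nat.Primes} (hπ : π ∈ σ) (x : G) :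
    Permutes (Subgroup.normalizer (H : Set G)) (conjugate (P π) x) := by
  set U := H ⊓ piRadical πᶜ G
  set V := H ⊓ piRadical π G
  have hPU : conjugate (P π) x ≤ Subgroup.normalizer (U : Set G) :=
    hR.conjugate_le_normalizer_compl hσ hP hπ x
  have hKV : projClosure (σ \ {π}) P ≤ Subgroup.normalizer (V : Set G) :=
    projClosure_le fun ρ hρ y => hR.conjugate_le_normalizer hσ hP hπ hρ.1 hρ.2 y
  have hpart : ∀ N : Subgroup G, N.Normal →
      Subgroup.normalizer (H : Set G) ≤ Subgroup.normalizer ((H ⊓ N : Subgroup G) : Set G) := by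
    intro N hN
    refine le_normalizer_of_conj_mem fun n hn h hh => ⟨?_, hN.conj_mem _ hh.2 _⟩
    exact (Subgroup.mem_normalizer_iff.1 hn h).1 hh.1
  have hNN : Subgroup.normalizer (U : Set G) ⊓ Subgroup.normalizer (V : Set G) ≤
      Subgroup.normalizer (H : Set G) := by
    refine le_normalizer_of_conj_mem fun n hn h hh => ?_
    have hsup : V ⊔ U ≤ H.comap (MulAut.conj n).toMonoidHom := by
      refine sup_le (fun v hv => ?_) (fun u hu => ?_)
      · exact ((Subgroup.mem_normalizer_iff.1 hn.2 v).1 hv).1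
      · exact ((Subgroup.mem_normalizer_iff.1 hn.1 u).1 hu).1
    rw [← hR.eq_sup hσ hπ] at hsup
    exact hsup hh
  refine Permutes.symm fun p hp n hn => ?_
  have hpn : p * n ∈ Subgroup.normalizer (U : Set G) :=
    mul_mem (hPU hp) (hpart _ inferInstance hn)
  obtain ⟨k, hk, q, hq, e⟩ := exists_mem_projClosure_mul hσ hP.maximal hπ x (p * n)
  refine ⟨k, hNN ⟨?_, hKV hk⟩, q, hq, e⟩
  rw [show k = p * n * q⁻¹ by rw [e]; group]
  exact mul_mem hpn (Subgroup.inv_mem _ (hPU hq))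

end IsRadicallyEmbedded

/-! ### Core-free permuting subgroups -/

/-- If no conjugate of a projector moves `H`, then `H` is normal, because the projectors and their
conjugates generate `G`. -/
lemma IsPermutingSystem.normal_of_conjugate_le [Finite G] {σ : Set (Set Nat.Primes)}
    (hσ : Setoid.IsPartition σ) {P : Set Nat.Primes → Subgroup G} {H : Subgroup G}
    (hP : IsPermutingSystem σ P H)
    (h : ∀ π ∈ σ, ∀ x, ∀ g ∈ conjugate (P π) x, conjugate H g ≤ H) : H.Normal := by
  rw [← Subgroup.normalizer_eq_top_iff, eq_top_iff, ← projClosure_eq_top hσ hP.maximal]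
  refine projClosure_le fun π hπ x => le_normalizer_of_conj_mem fun b hb s hs => ?_
  exact h π hπ x b⁻¹ (inv_mem hb) (mem_conjugate.2 (by simpa [mul_assoc] using hs))

/-- The situation of a core-free subgroup `H` permuting with the projectors, together with a normal
subgroup `C` such that `|HC : H|` is a `π₀`-number. -/
structure IsIndexExtension (σ : Set (Set Nat.Primes)) (P : Set Nat.Primes → Subgroup G)
    (H C : Subgroup G) (π₀ : Set Nat.Primes) : Prop where
  system : IsPermutingSystem σ P H
  core : H.normalCore = ⊥
  mem : π₀ ∈ σ
  normal : C.Normal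
  index : IsPiNumber π₀ (H.relIndex (H ⊔ C))

namespace IsIndexExtension

variable {σ : Set (Set Nat.Primes)} {P : Set Nat.Primes → Subgroup G} {H C : Subgroup G}
  {π₀ : Set Nat.Primes}

lemma conjugate_inf_le (hσ : Setoid.IsPartition σ) (h : IsIndexExtension σ P H C π₀)
    {π : Set Nat.Primes} (hπ : π ∈ σ) (hne : π ≠ π₀) (y : G) :
    conjugate (P π) y ⊓ (H ⊔ C) ≤ H :=
  (h.system.permutes π hπ y).inf_le_of_index le_sup_left
    ((h.system.maximal π hπ).isPiNumber_card_conjugate y) h.index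
    (disjoint_of_isPartition hσ hπ h.mem hne)

/-- For `π ≠ π₀` and a projector `P` for `π` one has `HP ∩ HC = H`, so `P` normalizes
`H ∩ C = HP ∩ C`. -/
lemma conjugate_le_normalizer (hσ : Setoid.IsPartition σ) (h : IsIndexExtension σ P H C π₀)
    {π : Set Nat.Primes} (hπ : π ∈ σ) (hne : π ≠ π₀) (y : G) :
    conjugate (P π) y ≤ Subgroup.normalizer ((H ⊓ C : Subgroup G) : Set G) := by
  have := h.normal
  refine le_normalizer_of_conj_mem fun p hp e he => ?_
  have hc : p * e * p⁻¹ ∈ C := h.normal.conj_mem _ he.2 _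
  have hs : p * e * p⁻¹ ∈ H ⊔ conjugate (P π) y :=
    mul_mem (mul_mem (Subgroup.mem_sup_right hp) (Subgroup.mem_sup_left he.1))
      (Subgroup.inv_mem _ (Subgroup.mem_sup_right hp))
  obtain ⟨k, hk, q, hq, eq⟩ := (h.system.permutes π hπ y).mem_sup.1 hs
  have hqH : q ∈ H := by
    refine h.conjugate_inf_le hσ hπ hne y ⟨hq, ?_⟩
    rw [show q = k⁻¹ * (p * e * p⁻¹) by rw [eq]; group]
    exact mul_mem (Subgroup.mem_sup_left (inv_mem hk)) (Subgroup.mem_sup_right hc)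
  exact ⟨eq ▸ mul_mem hk hqH, hc⟩

lemma projClosure_le_normalizer (hσ : Setoid.IsPartition σ) (h : IsIndexExtension σ P H C π₀) :
    projClosure (σ \ {π₀}) P ≤ Subgroup.normalizer ((H ⊓ C : Subgroup G) : Set G) :=
  projClosure_le fun _ hπ y => h.conjugate_le_normalizer hσ hπ.1 hπ.2 y

lemma isPiNumber_relIndex_inf (h : IsIndexExtension σ P H C π₀) :
    IsPiNumber π₀ ((H ⊓ C).relIndex C) := by
  have := h.normal
  have hperm : Permutes H C := (permutes_of_le_normalizer (by
    rw [Subgroup.normalizer_eq_top_iff.2 h.normal]; exact le_top)).symm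
  rw [Subgroup.inf_relIndex_right, ← hperm.relIndex_sup]
  exact h.index

/-- The normal subgroup `C` is a `π₀`-group: with `K` the normal closure of the projectors for the
other members of `σ`, the `π₀'`-elements of `C ∩ K` lie in `H ∩ C` and generate a normal subgroup
of `G`, which is trivial since `H` is core-free; and `G/K` is a `π₀`-group. -/
lemma isPiNumber_card [Finite G] (hσ : Setoid.IsPartition σ) (h : IsIndexExtension σ P H C π₀) :
    IsPiNumber π₀ (Nat.card C) := by
  have := h.normal
  set K := projClosure (σ \ {π₀}) P with hK
  refine isPiNumber_card_of_map C (QuotientGroup.mk' K) ?_ ?_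
  swap
  · exact (isPiNumber_card_quotient_projClosure_diff hσ h.system.maximal π₀).of_dvd
      (Subgroup.card_subgroup_dvd_card _)
  rw [QuotientGroup.ker_mk']
  let T : Set G := {z | z ∈ C ⊓ K ∧ IsPiNumber π₀ᶜ (orderOf z)}
  have hTH : ∀ z ∈ T, z ∈ H := by
    rintro z ⟨hz, hzo⟩
    have hperm : Permutes (H ⊓ C) (Subgroup.zpowers z) :=
      permutes_of_le_normalizer
        (by simpa using h.projClosure_le_normalizer hσ hz.2)
    exact (hperm.inf_le_of_index inf_le_right (by rwa [Nat.card_zpowers])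
      h.isPiNumber_relIndex_inf disjoint_compl_left ⟨Subgroup.mem_zpowers z, hz.1⟩).1
  have hT1 : ∀ z ∈ T, z = 1 := by
    have hcore : Subgroup.normalClosure T ≤ H.normalCore := by
      refine Subgroup.normal_le_normalCore.2 ((Subgroup.closure_le _).2 fun y hy => ?_)
      obtain ⟨z, hz, hzy⟩ := Group.mem_conjugatesOfSet_iff.1 hy
      obtain ⟨c, rfl⟩ := isConj_iff.1 hzy
      refine hTH _ ⟨Subgroup.Normal.conj_mem inferInstance _ hz.1 _, ?_⟩
      rw [orderOf_conj]; exact hz.2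
    intro z hz
    have := hcore (Subgroup.subset_normalClosure hz)
    rwa [h.core, Subgroup.mem_bot] at this
  intro p hp
  by_contra hpπ
  have : Fact (p : ℕ).Prime := ⟨p.2⟩
  obtain ⟨x, hx⟩ := exists_prime_orderOf_dvd_card' (p : ℕ) hp
  have hx' : orderOf (x : G) = p := by rw [Subgroup.orderOf_coe, hx]
  have h1 := hT1 x ⟨x.2, by
    rw [hx']; simpa using isPiNumber_prime_pow (show p ∈ π₀ᶜ from hpπ) 1⟩
  rw [h1, orderOf_one] at hx'
  exact p.2.one_lt.ne hx'

end IsIndexExtension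

lemma mem_sup_iff_mk'_mem_map {H C : Subgroup G} [C.Normal] {g : G} :
    g ∈ H ⊔ C ↔ QuotientGroup.mk' C g ∈ H.map (QuotientGroup.mk' C) := by
  rw [← Subgroup.mem_comap, QuotientGroup.comap_map_mk', sup_comm]

namespace IsIndexExtension

variable [Finite G] {σ : Set (Set Nat.Primes)} {P : Set Nat.Primes → Subgroup G} {H C : Subgroup G}
  {π₀ : Set Nat.Primes}

/-- For `π ≠ π₀`, all `π`-elements of `HC` lying in the preimage `L` of `O_π(G/C)` belong to `H`:
the groups `Q ∩ HC ∩ L`, with `Q` a conjugate of the projector, generate a normal subgroup `Z` of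
`HC ∩ L` contained in `H`, and `HC ∩ L = ZC` has `π₀`-index over `Z`. -/
lemma mem_of_isPiNumber_orderOf [C.Normal] (hσ : Setoid.IsPartition σ)
    (h : IsIndexExtension σ P H C π₀)
    {π : Set Nat.Primes} (hπ : π ∈ σ) (hne : π ≠ π₀) {w : G} (hwH : w ∈ H ⊔ C)
    (hwL : QuotientGroup.mk' C w ∈ piRadical π (G ⧸ C)) (hwo : IsPiNumber π (orderOf w)) :
    w ∈ H := by
  set f := QuotientGroup.mk' C with hf
  set L₀ : Subgroup G := (piRadical π (G ⧸ C)).comap f ⊓ (H ⊔ C) with hL₀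
  have hCL : C ≤ L₀ := by
    refine le_inf (fun c hc => ?_) le_sup_right
    have hfc : f c = 1 := (QuotientGroup.eq_one_iff c).2 hc
    rw [Subgroup.mem_comap, hfc]
    exact one_mem _
  set Z : Subgroup G := ⨆ y, conjugate (P π) y ⊓ L₀ with hZ
  have hZH : Z ≤ H := iSup_le fun y =>
    (inf_le_inf_left _ inf_le_right).trans (h.conjugate_inf_le hσ hπ hne y)
  have hZL : Z ≤ L₀ := iSup_le fun y => inf_le_right
  have hnorm : L₀ ≤ Subgroup.normalizer (Z : Set G) := by
    refine le_normalizer_of_conj_mem fun l hl => ?_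
    change Z ≤ Z.comap (MulAut.conj l).toMonoidHom
    refine iSup_le fun y z hz => ?_
    change l * z * l⁻¹ ∈ Z
    refine Subgroup.mem_iSup_of_mem (y * l⁻¹) (Subgroup.mem_inf.2
      ⟨?_, mul_mem (mul_mem hl hz.2) (inv_mem hl)⟩)
    rw [mem_conjugate_mul]
    simpa [mul_assoc] using hz.1
  have hidx : IsPiNumber π₀ (Z.relIndex L₀) := by
    rw [relIndex_eq_of_forall_mul hCL]
    · exact (h.isPiNumber_card hσ).of_dvd (Subgroup.relIndex_dvd_card _ _)
    · intro l hl
      have hmem := ((h.system.map f (QuotientGroup.mk'_surjective C)).maximal π hπ).piRadical_le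
        hl.1
      obtain ⟨p, hp, e⟩ := hmem
      have hc : l * p⁻¹ ∈ C := by
        rw [← QuotientGroup.ker_mk' C, MonoidHom.mem_ker, map_mul, map_inv]
        change f l * (f p)⁻¹ = 1
        rw [e, mul_inv_cancel]
      refine ⟨l * p⁻¹, hc, p, ?_, by group⟩
      refine Subgroup.mem_iSup_of_mem 1 ⟨by rwa [conjugate_one], ?_⟩
      rw [show p = (l * p⁻¹)⁻¹ * l by group]
      exact mul_mem (Subgroup.inv_mem _ (hCL hc)) hl
  have hw : w ∈ L₀ := ⟨hwL, hwH⟩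
  have hperm : Permutes Z (Subgroup.zpowers w) :=
    permutes_of_le_normalizer (by simpa using hnorm hw)
  exact hZH (hperm.inf_le_of_index hZL (by rwa [Nat.card_zpowers]) hidx
    (disjoint_of_isPartition hσ hπ h.mem hne) ⟨Subgroup.mem_zpowers w, hw⟩)

/-- For `π ≠ π₀`, the `π`-elements of `HC` lying in the preimage of `O_π(G/C)` centralize `C`.
They generate a subgroup `M ≤ H` normalized by the projector for `π₀`, while `H ∩ C` is normalized
by the projectors for the other members of `σ`; so all conjugates of `M ∩ C` lie in `H`, whence
`M ∩ C = 1`. -/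
lemma commute_of_isPiNumber_orderOf [C.Normal] (hσ : Setoid.IsPartition σ)
    (h : IsIndexExtension σ P H C π₀)
    (hR : IsRadicallyEmbedded σ (H.map (QuotientGroup.mk' C)))
    {π : Set Nat.Primes} (hπ : π ∈ σ) (hne : π ≠ π₀) {w c : G} (hwH : w ∈ H ⊔ C)
    (hwL : QuotientGroup.mk' C w ∈ piRadical π (G ⧸ C)) (hwo : IsPiNumber π (orderOf w))
    (hc : c ∈ C) : Commute w c := by
  set f := QuotientGroup.mk' C with hf
  have hfs : Function.Surjective f := QuotientGroup.mk'_surjective C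
  let T : Set G := {w | w ∈ H ⊔ C ∧ f w ∈ piRadical π (G ⧸ C) ∧ IsPiNumber π (orderOf w)}
  have hTH : Subgroup.closure T ≤ H := (Subgroup.closure_le _).2 fun z hz =>
    h.mem_of_isPiNumber_orderOf hσ hπ hne hz.1 hz.2.1 hz.2.2
  have hTconj : ∀ p ∈ conjugate (P π₀) 1, ∀ z ∈ T, p * z * p⁻¹ ∈ T := by
    intro p hp z hz
    have hfp : f p ∈ conjugate ((P π₀).map f) (f 1) := by
      rw [← map_conjugate]; exact Subgroup.mem_map_of_mem f hp
    have := (Subgroup.mem_normalizer_iff.1 (hR.conjugate_le_normalizer hσ (h.system.map f hfs)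
      hπ h.mem hne.symm (f 1) hfp) (f z)).1 ⟨mem_sup_iff_mk'_mem_map.1 hz.1, hz.2.1⟩
    rw [← map_inv, ← map_mul, ← map_mul] at this
    exact ⟨mem_sup_iff_mk'_mem_map.2 this.1, this.2, by rw [orderOf_conj]; exact hz.2.2⟩
  have hMconj : ∀ p ∈ conjugate (P π₀) 1, ∀ m ∈ Subgroup.closure T,
      p * m * p⁻¹ ∈ Subgroup.closure T := by
    intro p hp
    change Subgroup.closure T ≤ (Subgroup.closure T).comap (MulAut.conj p).toMonoidHom
    exact (Subgroup.closure_le _).2 fun z hz => Subgroup.subset_closure (hTconj p hp z hz)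
  have hfc : f c = 1 := (QuotientGroup.eq_one_iff c).2 hc
  have hw : w ∈ T := ⟨hwH, hwL, hwo⟩
  have hw' : c * w * c⁻¹ ∈ T := by
    refine ⟨mul_mem (mul_mem (Subgroup.mem_sup_right hc) hwH)
      (Subgroup.inv_mem _ (Subgroup.mem_sup_right hc)), ?_, by rw [orderOf_conj]; exact hwo⟩
    simpa [hfc] using hwL
  set m := w * (c * w * c⁻¹)⁻¹ with hm
  have hmM : m ∈ Subgroup.closure T :=
    mul_mem (Subgroup.subset_closure hw) (inv_mem (Subgroup.subset_closure hw'))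
  have hmC : m ∈ C := by
    rw [hm, show w * (c * w * c⁻¹)⁻¹ = w * c * w⁻¹ * c⁻¹ by group]
    exact mul_mem (h.normal.conj_mem c hc w) (inv_mem hc)
  have hmcore : m ∈ H.normalCore := by
    intro g
    obtain ⟨k, hk, p, hp, rfl⟩ := exists_mem_projClosure_mul hσ h.system.maximal h.mem 1 g
    have hE : p * m * p⁻¹ ∈ H ⊓ C := ⟨hTH (hMconj p hp m hmM), h.normal.conj_mem m hmC p⟩
    have := ((Subgroup.mem_normalizer_iff.1 (h.projClosure_le_normalizer hσ hk) _).1 hE).1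
    rwa [show k * p * m * (k * p)⁻¹ = k * (p * m * p⁻¹) * k⁻¹ by group]
  rw [h.core, Subgroup.mem_bot, hm, mul_inv_eq_one] at hmcore
  change w * c = c * w
  nth_rewrite 1 [hmcore]
  group

/-- If `H` is radically embedded modulo `C`, then it is so in `G`. -/
lemma isRadicallyEmbedded [C.Normal] (hσ : Setoid.IsPartition σ)
    (h : IsIndexExtension σ P H C π₀)
    (hR : IsRadicallyEmbedded σ (H.map (QuotientGroup.mk' C))) : IsRadicallyEmbedded σ H := by
  set f := QuotientGroup.mk' C with hf
  have hfs : Function.Surjective f := QuotientGroup.mk'_surjective C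
  have hCcard := h.isPiNumber_card hσ
  intro π hπ x hx hxo
  set L : Subgroup G := (piRadical π (G ⧸ C)).comap f with hL
  have hxL : f x ∈ piRadical π (G ⧸ C) :=
    hR π hπ _ (Subgroup.mem_map_of_mem f hx) (hxo.of_dvd (orderOf_map_dvd f x))
  by_cases hne : π = π₀
  · subst hne
    refine le_piRadical L (isPiNumber_card_of_map L f ?_ ?_) hxL
    · rw [hf, QuotientGroup.ker_mk']
      exact hCcard.of_le inf_le_right
    · rw [Subgroup.map_comap_eq_self_of_surjective hfs]
      exact isPiNumber_card_piRadical π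
  · let T : Set G := {w | w ∈ L ⊓ Subgroup.centralizer (C : Set G) ∧ IsPiNumber π (orderOf w)}
    -- If `w = pc` with `w ∈ T`, `p` in the projector and `c ∈ C`, then `w` and `p` commute, so
    -- `c` is both a `π`- and a `π₀`-element.
    have hTP : ∀ w ∈ T, w ∈ P π := by
      rintro w ⟨⟨hwL, hwC⟩, hwo⟩
      obtain ⟨p, hp, e⟩ := ((h.system.map f hfs).maximal π hπ).piRadical_le hwL
      have hc : p⁻¹ * w ∈ C := by
        rw [← QuotientGroup.ker_mk' C, MonoidHom.mem_ker, map_mul, map_inv]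
        change (f p)⁻¹ * f w = 1
        rw [e, inv_mul_cancel]
      have hcw : Commute (p⁻¹ * w) w := Subgroup.mem_centralizer_iff.1 hwC _ hc
      have hpw : Commute p⁻¹ w := by
        have := hcw.mul_left ((Commute.refl w).inv_left)
        simpa using this
      have hco : IsPiNumber π (orderOf (p⁻¹ * w)) := by
        refine IsPiNumber.of_dvd ?_ hpw.orderOf_mul_dvd_mul_orderOf
        refine IsPiNumber.mul ?_ hwo
        rw [orderOf_inv]
        exact (h.system.maximal π hπ).isPiNumber_card.of_dvd (Subgroup.orderOf_dvd_natCard _ hp)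
      have h1 := hco.eq_one (hCcard.of_dvd (Subgroup.orderOf_dvd_natCard _ hc))
        (disjoint_of_isPartition hσ hπ h.mem hne)
      rw [orderOf_eq_one_iff, inv_mul_eq_one] at h1
      exact h1 ▸ hp
    have hQ : Subgroup.normalClosure T ≤ P π := by
      refine (Subgroup.closure_le _).2 fun y hy => ?_
      obtain ⟨z, hz, hzy⟩ := Group.mem_conjugatesOfSet_iff.1 hy
      obtain ⟨g, rfl⟩ := isConj_iff.1 hzy
      exact hTP _ ⟨Subgroup.Normal.conj_mem inferInstance _ hz.1 _,
        by rw [orderOf_conj]; exact hz.2⟩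
    refine le_piRadical (Subgroup.normalClosure T)
      ((h.system.maximal π hπ).isPiNumber_card.of_le hQ)
      (Subgroup.subset_normalClosure ⟨⟨hxL, ?_⟩, hxo⟩)
    refine Subgroup.mem_centralizer_iff.2 fun c hc => ?_
    exact (h.commute_of_isPiNumber_orderOf hσ hR hπ hne (Subgroup.mem_sup_left hx) hxL hxo hc).symm

end IsIndexExtension

lemma normalCore_map_mk'_eq_bot {H H' N : Subgroup G} [N.Normal] (hle : H ⊔ N ≤ H')
    (hN : H'.normalCore = N) : (H.map (QuotientGroup.mk' N)).normalCore = ⊥ := by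
  rw [eq_bot_iff]
  intro x hx
  obtain ⟨g, rfl⟩ := QuotientGroup.mk'_surjective N x
  have hle' : ((H.map (QuotientGroup.mk' N)).normalCore).comap (QuotientGroup.mk' N) ≤ N := by
    refine le_of_le_of_eq (Subgroup.normal_le_normalCore.2 (le_trans ?_ hle)) hN
    have := Subgroup.comap_mono (f := QuotientGroup.mk' N)
      (Subgroup.normalCore_le (H.map (QuotientGroup.mk' N)))
    rwa [QuotientGroup.comap_map_mk', sup_comm] at this
  exact (QuotientGroup.eq_one_iff g).2 (hle' hx)

/-- A core-free subgroup permuting with all conjugates of a projector for each member of `σ` is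
contained in the product of the radicals `O_π(G)`. -/
theorem isRadicallyEmbedded_of_normalCore_eq_bot {σ : Set (Set Nat.Primes)}
    (hσ : Setoid.IsPartition σ) (n : ℕ) :
    ∀ (G : Type u) [Group G] [Finite G], Nat.card G = n →
      ∀ (P : Set Nat.Primes → Subgroup G) (H : Subgroup G), IsPermutingSystem σ P H →
        H.normalCore = ⊥ → IsRadicallyEmbedded σ H := by
  induction n using Nat.strong_induction_on with
  | _ n ih =>
  intro G _ _ hn P A hA hAcore
  -- It suffices to treat a maximal core-free permuting subgroup `H`.
  obtain ⟨H, hAH, hH⟩ := Set.Finite.exists_le_maximal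
    (s := {M : Subgroup G | IsPermutingSystem σ P M ∧ M.normalCore = ⊥}) (Set.toFinite _)
    (a := A) ⟨hA, hAcore⟩
  obtain ⟨hsys, hcore⟩ := hH.prop
  suffices hR : IsRadicallyEmbedded σ H from fun π hπ h hh => hR π hπ h (hAH hh)
  by_cases hconj : ∀ π ∈ σ, ∀ x, ∀ g ∈ conjugate (P π) x, conjugate H g ≤ H
  · have := hsys.normal_of_conjugate_le hσ hconj
    rw [Subgroup.normalCore_eq_self] at hcore
    intro π _ h hh _
    rw [hcore, Subgroup.mem_bot] at hh
    rw [hh]; exact one_mem _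
  · push Not at hconj
    obtain ⟨π₀, hπ₀, x, g, hg, hgH⟩ := hconj
    have hsys' : IsPermutingSystem σ P (H ⊔ conjugate H g) :=
      ⟨hsys.maximal, fun π hπ y => (hsys.permutes π hπ y).sup_left
        (Permutes.conjugate_left (hsys.permutes π hπ) g y)⟩
    set C := (H ⊔ conjugate H g).normalCore with hC
    have hCne : C ≠ ⊥ := fun hbot =>
      hgH (le_sup_right.trans (hH.le_of_ge (y := H ⊔ conjugate H g) ⟨hsys', hbot⟩ le_sup_left))
    have hHC : H ⊔ C ≤ H ⊔ conjugate H g := sup_le le_sup_left (Subgroup.normalCore_le _)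
    have hHP : H ⊔ conjugate H g ≤ H ⊔ conjugate (P π₀) x := by
      refine sup_le le_sup_left fun z hz => ?_
      rw [mem_conjugate] at hz
      rw [show z = g⁻¹ * (g * z * g⁻¹) * g by group]
      exact mul_mem (mul_mem (Subgroup.inv_mem _ (Subgroup.mem_sup_right hg))
        (Subgroup.mem_sup_left hz)) (Subgroup.mem_sup_right hg)
    have hext : IsIndexExtension σ P H C π₀ := by
      refine ⟨hsys, hcore, hπ₀, inferInstance, ?_⟩
      refine IsPiNumber.of_dvd (n := H.relIndex (H ⊔ conjugate (P π₀) x)) ?_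
        ⟨_, (Subgroup.relIndex_mul_relIndex _ _ _ le_sup_left (hHC.trans hHP)).symm⟩
      rw [(hsys.permutes π₀ hπ₀ x).relIndex_sup]
      exact ((hsys.maximal π₀ hπ₀).isPiNumber_card_conjugate x).of_dvd
        (Subgroup.relIndex_dvd_card _ _)
    have hlt : Nat.card (G ⧸ C) < n := by
      rw [← hn, Subgroup.card_eq_card_quotient_mul_card_subgroup C]
      exact lt_mul_of_one_lt_right Nat.card_pos (Subgroup.one_lt_card_iff_ne_bot C |>.2 hCne)
    exact hext.isRadicallyEmbedded hσ (ih _ hlt (G ⧸ C) rfl _ _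
      (hsys.map (QuotientGroup.mk' C) (QuotientGroup.mk'_surjective C))
      (normalCore_map_mk'_eq_bot hHC rfl))

end

end SigmaPerm

theorem theorem5 {G : Type*} [Group G] [Finite G]
    (σ : Set (Set Nat.Primes)) (hσ : Setoid.IsPartition σ)
    (H : Subgroup G) (hH : SigmaPerm.IsSigma3Permutable σ H) :
    SigmaPerm.IsSigma3Permutable σ (Subgroup.normalizer (H : Set G)) := by
  open SigmaPerm in
  choose! P hP hperm using hH
  have hsys : IsPermutingSystem σ P H :=
    ⟨fun π hπ => isImageMaximal_of_isProjector (hP π hπ),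
      fun π hπ x => permutes_iff.2 (hperm π hπ x)⟩
  set f := QuotientGroup.mk' H.normalCore with hf
  have hfs : Function.Surjective f := QuotientGroup.mk'_surjective _
  have hsys' := hsys.map f hfs
  have hle : H ⊔ H.normalCore ≤ H := sup_le le_rfl (Subgroup.normalCore_le H)
  have hR := isRadicallyEmbedded_of_normalCore_eq_bot hσ _ _ rfl _ _ hsys'
    (normalCore_map_mk'_eq_bot hle rfl)
  have hN : ∀ g : G, f g ∈ Subgroup.normalizer ((H.map f : Subgroup (G ⧸ H.normalCore)) :
      Set (G ⧸ H.normalCore)) ↔ g ∈ Subgroup.normalizer (H : Set G) := by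
    intro g
    rw [← Subgroup.mem_comap, Subgroup.comap_normalizer_eq_of_surjective _ hfs, hf,
      QuotientGroup.comap_map_mk', sup_eq_right.2 (Subgroup.normalCore_le H)]
  intro π hπ
  refine ⟨P π, hP π hπ, fun x => permutes_iff.1 fun n hn p hp => ?_⟩
  have hq := hR.permutes_normalizer hσ hsys' hπ (f x)
  rw [← map_conjugate] at hq
  obtain ⟨_, ⟨p', hp', rfl⟩, m, hm, e⟩ := hq (f n) ((hN n).2 hn) (f p)
    (Subgroup.mem_map_of_mem f hp)
  refine ⟨p', hp', p'⁻¹ * (n * p), (hN _).1 ?_, by group⟩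
  rwa [map_mul, map_mul, map_inv, e, inv_mul_cancel_left]
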